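/- Let $n,r\ge 0$. For $1\le i,j\le n$ let $e_{ij}$ be the matrix units of $\mathfrak{gl}_n(\mathbb Q)$, regarded as elements of the universal enveloping algebra $\mathfrak U=\mathfrak U(\mathfrak{gl}_n)$ over $\mathbb Q$, and put $f_{ij}=e_{ji}$, $H_i=e_{ii}$, $X^{(a)}=X^a/a!$, $\binom{X}{a}=X(X-1)\cdots(X-a+1)/a!$. Let $\mathfrak U_{\mathbb Z}\subseteq\mathfrak U$ be the subring generated by all $f_{i,i+1}^{(a)}$, $\binom{H_i}{b}$, $e_{i,i+1}^{(c)}$ ($a,b,c\ge 0$). Let $\mathsf E=\mathbb Q^n$, let $d\rho:\mathfrak U\to\operatorname{End}_{\mathbb Q}(\mathsf E^{\otimes r})$ be the algebra homomorphism for which $X\in\mathfrak{gl}_n$ acts by $X(v_1\otimes\cdots\otimes v_r)=\sum_k v_1\otimes\cdots\otimes Xv_k\otimes\cdots\otimes v_r$, and let $S_{\mathbb Z}(n,r)=d\rho(\mathfrak U_{\mathbb Z})$ be the integral Schur algebra. Write $f_{ij}^{(a)}$, $e_{ij}^{(a)}$ also for the images of these elements under $d\rho$. Let $\Lambda(n,r)=\{\lambda\in\mathbb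 N^n:\sum_i\lambda_i=r\}$ and, for $\lambda\in\Lambda(n,r)$, let $1_\lambda$ be the projection of $\mathsf E^{\otimes r}$ onto the span of the standard basis vectors $\mathsf e_{i_1}\otimes\cdots\otimes \mathsf e_{i_r}$ of weight $\lambda$ (that is, with exactly $\lambda_j$ of the $i_k$ equal to $j$, for every $j$) which kills the standard basis vectors of all other weights. Let $\lambda,\mu\in\Lambda(n,r)$, and let ${}_\lambda\Theta_\mu$ be the set of all $n\times n$ matrices $A=(a_{ij})$ over $\mathbb N$ with row sums $\lambda$ and column sums $\mu$. Fix an arbitrary order on the pairs $(i,j)$ with $i<j$ for the products of the $f$'s, and an arbitrary order on these pairs for the products of the $e$'s. Then the elements $$1_{\lambda}\,\Bigl(\prod_{i<j} f_{ij}^{(a_{ji})}\prod_{i<j} e_{ij}^{(a_{ij})}\Bigr)\,1_{\mu}\qquad(A\in{}_\lambda\Theta_\mu)$$ form a $\mathbb Z$-basis of $1_\lambda S_{\mathbb Z}(n,r)1_\mu$, and the elements $$1_{\lambda}\,\Bigl(\prod_{i<j} e_{ij}^{(a_{ij})}\prod_{i<j} f_{ij}^{(a_{ji})}\Bigr)\,1_{\mu}\qquad(A\in{}_\lambda\Theta_\mu)$$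 form another one (in both cases distinct $A$ give distinct elements). -/

import Mathlib

open scoped TensorProduct Nat

noncomputable section

namespace IntegralSchur

attribute [local instance 100] LieRing.ofAssociativeRing

/-- The Lie algebra `gl_n` over `ℚ`, with bracket `[X, Y] = XY - YX`. -/
abbrev Gl (n : ℕ) : Type := Matrix (Fin n) (Fin n) ℚ

/-- The universal enveloping algebra of `gl_n` over `ℚ`. -/
abbrev U (n : ℕ) : Type := UniversalEnvelopingAlgebra ℚ (Gl n)

/-- The matrix unit `e_{ij}`, viewed in the enveloping algebra. -/
def e {n : ℕ} (i j : Fin n) : U n :=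
  UniversalEnvelopingAlgebra.ι ℚ (Matrix.single i j (1 : ℚ) : Gl n)

/-- `f_{ij} = e_{ji}`. -/
def f {n : ℕ} (i j : Fin n) : U n := e j i

/-- `H_i = e_{ii}`. -/
def H {n : ℕ} (i : Fin n) : U n := e i i

/-- The divided power `X^{(a)} = X^a / a!`. -/
def divPow {n : ℕ} (X : U n) (a : ℕ) : U n := ((a ! : ℚ))⁻¹ • X ^ a

/-- The binomial `X (X - 1) ⋯ (X - a + 1) / a!`. -/
def binom {n : ℕ} (X : U n) (a : ℕ) : U n :=
  ((a ! : ℚ))⁻¹ • Polynomial.aeval X (descPochhammer ℚ a)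

/-- The integral form (hyperalgebra) of `U n`: the subring generated by the divided powers of
the simple root vectors `e_{i,i+1}`, `f_{i,i+1} = e_{i+1,i}` and by the binomials in the `H_i`. -/
def UZ (n : ℕ) : Subring (U n) :=
  Subring.closure
    ({x | ∃ (i j : Fin n) (a : ℕ), (i : ℕ) + 1 = j ∧ x = divPow (f i j) a} ∪
      {x | ∃ (i : Fin n) (b : ℕ), x = binom (H i) b} ∪
      {x | ∃ (i j : Fin n) (c : ℕ), (i : ℕ) + 1 = j ∧ x = divPow (e i j) c})

/-- The tensor space `E^{⊗ r}`, where `E = ℚ^n`. -/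
abbrev TensorSpace (n r : ℕ) : Type := ⨂[ℚ] _ : Fin r, (Fin n → ℚ)

/-- `X` acting on the `k`-th tensor factor, and as the identity on the others. -/
def actAt (n r : ℕ) (k : Fin r) : Gl n →ₗ[ℚ] Module.End ℚ (TensorSpace n r) :=
  (PiTensorProduct.mapMultilinear ℚ (fun _ : Fin r => Fin n → ℚ)
      (fun _ : Fin r => Fin n → ℚ)).toLinearMap (fun _ => LinearMap.id) k ∘ₗ
    (Matrix.toLin' : Gl n ≃ₗ[ℚ] ((Fin n → ℚ) →ₗ[ℚ] (Fin n → ℚ))).toLinearMap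

theorem actAt_apply (n r : ℕ) (k : Fin r) (X : Gl n) :
    actAt n r k X = PiTensorProduct.mapMonoidHom
      (Pi.mulSingle (M := fun _ : Fin r => Module.End ℚ (Fin n → ℚ)) k (Matrix.toLin' X)) := rfl

theorem actAt_mul (n r : ℕ) (k : Fin r) (X Y : Gl n) :
    actAt n r k (X * Y) = actAt n r k X * actAt n r k Y := by
  simp only [actAt_apply, ← map_mul, ← Pi.mulSingle_mul, Module.End.mul_eq_comp,
    Matrix.toLin'_mul]

theorem actAt_comm (n r : ℕ) {k l : Fin r} (hkl : k ≠ l) (X Y : Gl n) :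
    actAt n r k X * actAt n r l Y = actAt n r l Y * actAt n r k X := by
  simp only [actAt_apply, ← map_mul]
  congr 1
  exact Pi.mulSingle_commute hkl _ _

theorem sum_commutator {A : Type*} [Ring A] {r : ℕ} (a b : Fin r → A)
    (h : ∀ k l, k ≠ l → a k * b l = b l * a k) :
    ∑ k, (a k * b k - b k * a k) = (∑ k, a k) * (∑ k, b k) - (∑ k, b k) * (∑ k, a k) := by
  simp only [Finset.sum_mul_sum]
  rw [Finset.sum_comm (f := fun k l => b k * a l), ← Finset.sum_sub_distrib]
  refine Finset.sum_congr rfl fun k _ => ?_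
  rw [← Finset.sum_sub_distrib, Finset.sum_eq_single k]
  · intro l _ hl
    rw [h k l hl.symm, sub_self]
  · simp

/-- The action of `gl_n` on `E^{⊗ r}`, the differential of the diagonal action of `GL_n`:
`X (v_1 ⊗ ⋯ ⊗ v_r) = ∑_k v_1 ⊗ ⋯ ⊗ X v_k ⊗ ⋯ ⊗ v_r`. -/
def glAction (n r : ℕ) : Gl n →ₗ⁅ℚ⁆ Module.End ℚ (TensorSpace n r) :=
  { (∑ k : Fin r, actAt n r k : Gl n →ₗ[ℚ] Module.End ℚ (TensorSpace n r)) with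
    map_lie' := by
      intro X Y
      have key := sum_commutator (fun k => actAt n r k X) (fun k => actAt n r k Y)
        fun k l hkl => actAt_comm n r hkl X Y
      simp only [AddHom.toFun_eq_coe, LinearMap.coe_toAddHom, LinearMap.sum_apply]
      refine Eq.trans (Finset.sum_congr rfl fun k _ => ?_) key
      rw [← actAt_mul, ← actAt_mul]
      exact map_sub (actAt n r k) (X * Y) (Y * X) }

/-- The representation `dρ` of the enveloping algebra on `E^{⊗ r}`. -/
def dRho (n r : ℕ) : U n →ₐ[ℚ] Module.End ℚ (TensorSpace n r) :=
  UniversalEnvelopingAlgebra.lift ℚ (glAction n r)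

/-- The integral Schur algebra `S_ℤ(n, r)`: the image of the integral form under `dρ`. -/
def SZ (n r : ℕ) : Subring (Module.End ℚ (TensorSpace n r)) :=
  (UZ n).map (dRho n r : U n →+* Module.End ℚ (TensorSpace n r))

/-- `Λ(n, r)`: the compositions of `r` with `n` parts, zero parts being allowed. -/
def Comps (n r : ℕ) : Set (Fin n → ℕ) := {lam | ∑ i, lam i = r}

/-- The weight of a multi-index: its `j`-th part is the number of entries equal to `j`. -/
def wt {n r : ℕ} (i : Fin r → Fin n) : Fin n → ℕ :=
  fun j => (Finset.univ.filter fun k => i k = j).card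

/-- The standard basis `e_{i_1} ⊗ ⋯ ⊗ e_{i_r}` of the tensor space. -/
def stdBasis (n r : ℕ) : Module.Basis (Fin r → Fin n) ℚ (TensorSpace n r) :=
  Basis.piTensorProduct fun _ : Fin r => Pi.basisFun ℚ (Fin n)

/-- The idempotent `1_λ`: the projection onto the span of the standard basis vectors of
weight `λ` that kills all other standard basis vectors. -/
def idem {n r : ℕ} (lam : Fin n → ℕ) : Module.End ℚ (TensorSpace n r) :=
  (stdBasis n r).constr ℚ fun i => if wt i = lam then stdBasis n r i else 0

/-- `1_λ S_ℤ(n, r) 1_μ`, as a `ℤ`-submodule of the endomorphisms of the tensor space. -/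
def SZweight (n r : ℕ) (lam mu : Fin n → ℕ) : Submodule ℤ (Module.End ℚ (TensorSpace n r)) where
  carrier := {y | ∃ x ∈ SZ n r, y = idem lam * x * idem mu}
  zero_mem' := ⟨0, (SZ n r).zero_mem, by simp⟩
  add_mem' := by
    rintro _ _ ⟨x, hx, rfl⟩ ⟨y, hy, rfl⟩
    exact ⟨x + y, (SZ n r).add_mem hx hy, by rw [mul_add, add_mul]⟩
  smul_mem' := by
    rintro c _ ⟨x, hx, rfl⟩
    exact ⟨c • x, (SZ n r).zsmul_mem hx c, by rw [mul_smul_comm, smul_mul_assoc]⟩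

/-- The `n × n` matrices over `ℕ` with row sums `λ` and column sums `μ`. -/
def Theta {n : ℕ} (lam mu : Fin n → ℕ) : Set (Matrix (Fin n) (Fin n) ℕ) :=
  {A | (∀ i, ∑ j, A i j = lam i) ∧ ∀ j, ∑ i, A i j = mu j}

/-- A total order on the set of pairs `i < j`, given as a list of these pairs. -/
def IsOrdering {n : ℕ} (l : List (Fin n × Fin n)) : Prop :=
  l.Nodup ∧ ∀ p : Fin n × Fin n, p ∈ l ↔ p.1 < p.2

/-- `∏_{i<j} f_{ij}^{(a_{ji})}`, in the order given by the list `l`. -/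
def fProd {n : ℕ} (l : List (Fin n × Fin n)) (A : Matrix (Fin n) (Fin n) ℕ) : U n :=
  (l.map fun p => divPow (f p.1 p.2) (A p.2 p.1)).prod

/-- `∏_{i<j} e_{ij}^{(a_{ij})}`, in the order given by the list `l`. -/
def eProd {n : ℕ} (l : List (Fin n × Fin n)) (A : Matrix (Fin n) (Fin n) ℕ) : U n :=
  (l.map fun p => divPow (e p.1 p.2) (A p.1 p.2)).prod

end IntegralSchur

end

/-! In the standard basis of tensor space, elements of `SZ n r` become integral matrices invariant
under simultaneous permutation of the tensor positions (`matRep_mem_integralInvariants`). Orbits of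
pairs `(x, y)` of multi-indices of weights `λ`, `μ` correspond to the matrices in `Theta lam mu`
through `pairCount`, so reading one entry per orbit embeds `SZweight` in `ℤ^Theta`.

Since `E_{ij}² = 0` for `i ≠ j`, the divided power of `e_{ij}` acts as a coefficient of `(1 + t
E_{ij})^{⊗r}`. A product of divided powers is therefore the coefficient of one monomial in `g^{⊗r}`,
where `g = ∏ (1 + t_p E_p)` runs over the off-diagonal pairs in the chosen order. Whatever the
order, `g ≡ 1 + ∑ t_p E_p` modulo terms of degree two, so the `(x, y)` entry of `g^{⊗r}` has lowest
term the monomial of the off-diagonal part of `pairCount x y` (`coeff_tensorPow_elemProd_apply`).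

Graded by off-diagonal degree, the proposed basis thus has a unitriangular coordinate matrix, so it
already spans `ℤ^Theta` and the embedding is onto (`exists_basis_of_unitriangular`). That the
products lie in `SZ` for non-simple roots follows from a group commutator identity
(`divMat_single_mem_of_trans`). -/

open scoped TensorProduct Nat

noncomputable section

namespace IntegralSchur

attribute [local instance] LieRing.ofAssociativeRing

open Finset Matrix

/-! ### Tensor powers of matrices and their divided-power coefficients -/

section TensorPower

variable {n r : ℕ} {R : Type*} [CommRing R]

/-- The matrix of `g_1 ⊗ ⋯ ⊗ g_r` in the standard basis of the tensor space. -/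
def tensorMat (g : Fin r → Matrix (Fin n) (Fin n) R) :
    Matrix (Fin r → Fin n) (Fin r → Fin n) R :=
  Matrix.of fun x y => ∏ k, g k (x k) (y k)

theorem tensorMat_apply (g : Fin r → Matrix (Fin n) (Fin n) R) (x y : Fin r → Fin n) :
    tensorMat g x y = ∏ k, g k (x k) (y k) := rfl

theorem tensorMat_mul (g h : Fin r → Matrix (Fin n) (Fin n) R) :
    tensorMat g * tensorMat h = tensorMat (g * h) := by
  ext x y
  simp only [tensorMat_apply, Matrix.mul_apply, Pi.mul_apply, ← prod_mul_distrib]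
  rw [Finset.prod_univ_sum, Fintype.piFinset_univ]

theorem tensorMat_one : tensorMat (1 : Fin r → Matrix (Fin n) (Fin n) R) = 1 := by
  ext x y
  simp only [tensorMat_apply, Pi.one_apply, Matrix.one_apply, Finset.prod_ite_zero, funext_iff]
  simp

theorem tensorMat_eq_zero (g : Fin r → Matrix (Fin n) (Fin n) R) (k : Fin r) (hk : g k = 0) :
    tensorMat g = 0 := by
  ext x y
  rw [tensorMat_apply]
  exact prod_eq_zero (mem_univ k) (by simp [hk])

/-- The coefficient of `t ^ a` in `(1 + t M)^{⊗ r}`. -/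
def divMat (r : ℕ) (M : Matrix (Fin n) (Fin n) R) (a : ℕ) :
    Matrix (Fin r → Fin n) (Fin r → Fin n) R :=
  ∑ s ∈ powersetCard a univ, tensorMat fun k => if k ∈ s then M else 1

theorem divMat_zero (M : Matrix (Fin n) (Fin n) R) : divMat r M 0 = 1 := by
  simp only [divMat, powersetCard_zero, sum_singleton, notMem_empty, if_false]
  exact tensorMat_one

/-- Multiplying `M` at position `j` by `M` at the positions `s` gives zero if `j ∈ s`, as `M² = 0`;
otherwise it gives `M` at `insert j s`, and each set of size `a + 1` arises from `a + 1` choices of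
`j`. -/
theorem divMat_one_mul_divMat (M : Matrix (Fin n) (Fin n) R) (hM : M * M = 0) (a : ℕ) :
    divMat r M 1 * divMat r M a = (a + 1) • divMat r M (a + 1) := by
  have h1 : divMat r M 1 = ∑ j : Fin r, tensorMat fun k => if k = j then M else 1 := by
    simp [divMat, powersetCard_one]
  have h2 : ∀ s ∈ powersetCard (a + 1) (univ : Finset (Fin r)),
      (a + 1) • tensorMat (fun k => if k ∈ s then M else 1) =
        ∑ j ∈ s, tensorMat (fun k => if k ∈ s then M else 1) := by
    intro s hs
    rw [sum_const, (mem_powersetCard.1 hs).2]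
  have h3 : ∀ (j : Fin r) (s : Finset (Fin r)),
      tensorMat (fun k => if k = j then M else 1) * tensorMat (fun k => if k ∈ s then M else 1) =
      if j ∈ s then 0 else tensorMat (fun k => if k ∈ insert j s then M else 1) := by
    intro j s
    rw [tensorMat_mul]
    split_ifs with h
    · exact tensorMat_eq_zero _ j (by simp [h, hM])
    · congr 1
      funext k
      by_cases hk : k = j
      · subst hk; simp [h]
      · simp [hk]
  rw [h1, divMat, divMat, smul_sum, sum_congr rfl h2, sum_mul_sum]
  have h4 : ∀ j : Fin r, ∑ s ∈ powersetCard a univ,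
      tensorMat (fun k => if k = j then M else 1) * tensorMat (fun k => if k ∈ s then M else 1) =
      ∑ s ∈ powersetCard a univ with j ∉ s,
        tensorMat (fun k => if k ∈ insert j s then M else 1) := by
    intro j
    rw [sum_filter]
    refine sum_congr rfl fun s _ => ?_
    rw [h3, ite_not]
  rw [sum_congr rfl fun j _ => h4 j]
  rw [sum_sigma', sum_sigma']
  refine sum_bij' (fun p _ => ⟨insert p.1 p.2, p.1⟩) (fun p _ => ⟨p.2, p.1.erase p.2⟩) ?_ ?_ ?_ ?_ ?_
  · rintro ⟨j, s⟩ h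
    simp only [mem_sigma, mem_univ, mem_filter, mem_powersetCard, subset_univ, true_and] at h ⊢
    exact ⟨by rw [card_insert_of_notMem h.2, h.1], mem_insert_self _ _⟩
  · rintro ⟨s, j⟩ h
    simp only [mem_sigma, mem_univ, mem_filter, mem_powersetCard, subset_univ, true_and] at h ⊢
    exact ⟨by rw [card_erase_of_mem h.2, h.1]; rfl, notMem_erase _ _⟩
  · rintro ⟨j, s⟩ h
    simp only [mem_sigma, mem_univ, mem_filter, true_and] at h
    simp [erase_insert h.2]
  · rintro ⟨s, j⟩ h
    simp only [mem_sigma] at h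
    simp [insert_erase h.2]
  · rintro ⟨j, s⟩ h
    rfl

theorem divMat_one_pow (M : Matrix (Fin n) (Fin n) R) (hM : M * M = 0) (a : ℕ) :
    divMat r M 1 ^ a = (a !) • divMat r M a := by
  induction a with
  | zero => simp [divMat_zero]
  | succ a ih =>
    rw [pow_succ', ih, mul_smul_comm, divMat_one_mul_divMat M hM, smul_smul, Nat.factorial_succ,
      mul_comm]

/-- The matrix of `g^{⊗ r}` in the standard basis of the tensor space. -/
def tensorPow (r : ℕ) : Matrix (Fin n) (Fin n) R →* Matrix (Fin r → Fin n) (Fin r → Fin n) R where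
  toFun g := tensorMat fun _ => g
  map_one' := tensorMat_one
  map_mul' _ _ := (tensorMat_mul _ _).symm

theorem tensorPow_apply (g : Matrix (Fin n) (Fin n) R) (x y : Fin r → Fin n) :
    tensorPow r g x y = ∏ k, g (x k) (y k) := rfl

/-- The change of rings `ψ` lets `t` be a polynomial variable while `M` stays rational. -/
theorem tensorPow_one_add_smul {S : Type*} [CommRing S] (ψ : R →+* S)
    (M : Matrix (Fin n) (Fin n) R) (t : S) (x y : Fin r → Fin n) :
    tensorPow r (1 + t • M.map ψ) x y = ∑ a ∈ range (r + 1), t ^ a * ψ (divMat r M a x y) := by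
  have h1 : (1 : Matrix (Fin n) (Fin n) S) = (1 : Matrix (Fin n) (Fin n) R).map ψ := by simp
  have hz : tensorPow r (1 + t • M.map ψ) x y = ∑ s ∈ (univ : Finset (Fin r)).powerset,
      t ^ #s * ψ (tensorMat (fun k => if k ∈ s then M else 1) x y) := by
    rw [tensorPow_apply]
    simp only [Matrix.add_apply, Matrix.smul_apply, smul_eq_mul]
    simp_rw [add_comm (_ : S) (t * _)]
    rw [prod_add]
    refine sum_congr rfl fun s _ => ?_
    rw [prod_mul_distrib, prod_const, mul_assoc, tensorMat_apply, map_prod,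
      ← prod_sdiff (subset_univ s), mul_comm (∏ i ∈ s, _)]
    congr 2
    · refine prod_congr rfl fun k hk => ?_
      rw [if_neg (mem_sdiff.1 hk).2, h1, Matrix.map_apply]
    · refine prod_congr rfl fun k hk => ?_
      rw [if_pos hk, Matrix.map_apply]
  rw [hz, sum_powerset, card_univ, Fintype.card_fin]
  refine sum_congr rfl fun a _ => ?_
  rw [divMat, Matrix.sum_apply, map_sum, mul_sum]
  refine sum_congr rfl fun s hs => ?_
  rw [(mem_powersetCard.1 hs).2]

end TensorPower

/-! ### The action of the generators as explicit matrices -/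

section Representation

variable {n r : ℕ}

/-- The representation `dρ`, in matrix form. -/
def matRep (n r : ℕ) : U n →ₐ[ℚ] Matrix (Fin r → Fin n) (Fin r → Fin n) ℚ :=
  (LinearMap.toMatrixAlgEquiv (stdBasis n r) : _ →ₐ[ℚ] _).comp (dRho n r)

theorem matRep_apply (u : U n) :
    matRep n r u = LinearMap.toMatrixAlgEquiv (stdBasis n r) (dRho n r u) := rfl

theorem toMatrix_actAt (k : Fin r) (M : Gl n) :
    LinearMap.toMatrixAlgEquiv (stdBasis n r) (actAt n r k M) =
      tensorMat fun l => if l = k then M else 1 := by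
  ext x y
  rw [LinearMap.toMatrixAlgEquiv_apply, actAt_apply, stdBasis, Basis.piTensorProduct_apply,
    tensorMat_apply]
  change Module.Basis.repr _ (PiTensorProduct.map _ _) _ = _
  rw [PiTensorProduct.map_tprod, Basis.piTensorProduct_repr_tprod_apply]
  refine prod_congr rfl fun l _ => ?_
  by_cases h : l = k
  · subst h
    simp
  · simp [h, Matrix.one_apply, Pi.single_apply]

theorem matRep_ι (M : Gl n) :
    matRep n r (UniversalEnvelopingAlgebra.ι ℚ M) = divMat r M 1 := by
  have : dRho n r (UniversalEnvelopingAlgebra.ι ℚ M) = ∑ k, actAt n r k M := by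
    rw [dRho, UniversalEnvelopingAlgebra.lift_ι_apply]
    change (∑ k : Fin r, actAt n r k : Gl n →ₗ[ℚ] _) M = _
    rw [LinearMap.sum_apply]
  rw [matRep_apply, this, map_sum]
  simp only [toMatrix_actAt]
  simp [divMat, powersetCard_one]

theorem single_mul_self {i j : Fin n} (h : i ≠ j) :
    (Matrix.single i j 1 : Gl n) * Matrix.single i j 1 = 0 := by
  rw [Matrix.single_mul_single_of_ne _ _ _ _ h.symm]

theorem matRep_divPow {i j : Fin n} (h : i ≠ j) (a : ℕ) :
    matRep n r (divPow (e i j) a) = divMat r (Matrix.single i j 1 : Gl n) a := by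
  rw [divPow, map_smul, map_pow, e, matRep_ι, divMat_one_pow _ (single_mul_self h),
    ← Nat.cast_smul_eq_nsmul ℚ, smul_smul, inv_mul_cancel₀ (by exact_mod_cast a.factorial_ne_zero),
    one_smul]

theorem matRep_H (i : Fin n) :
    matRep n r (H i) = Matrix.diagonal fun x : Fin r → Fin n => (wt x i : ℚ) := by
  rw [H, e, matRep_ι]
  ext x y
  simp only [divMat, powersetCard_one, sum_map, Function.Embedding.coeFn_mk, mem_singleton,
    Matrix.sum_apply, tensorMat_apply]
  have key : ∀ k : Fin r, ∏ l, (if l = k then (Matrix.single i i 1 : Gl n) else 1) (x l) (y l) =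
      if x = y then if x k = i then 1 else 0 else 0 := by
    intro k
    split_ifs with h h'
    · subst h
      refine prod_eq_one fun l _ => ?_
      split_ifs with hl
      · subst hl; simp [h']
      · simp
    · exact prod_eq_zero (mem_univ k) (by simp [Ne.symm h'])
    · obtain ⟨l, hl⟩ := Function.ne_iff.1 h
      refine prod_eq_zero (mem_univ l) ?_
      split_ifs with hlk
      · rw [Matrix.single_apply, if_neg]
        rintro ⟨h1, h2⟩
        exact hl (h1.symm.trans h2)
      · exact Matrix.one_apply_ne hl
  rw [sum_congr rfl fun k _ => key k, Matrix.diagonal_apply]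
  split_ifs with h
  · simp [wt]
  · simp

theorem matRep_binom (i : Fin n) (b : ℕ) :
    matRep n r (binom (H i) b) =
      Matrix.diagonal fun x : Fin r → Fin n => ((wt x i).choose b : ℚ) := by
  rw [binom, map_smul, ← Polynomial.aeval_algHom_apply, matRep_H]
  -- Diagonal matrices form the image of an algebra homomorphism, so the polynomial is evaluated
  -- entry by entry.
  change _ • Polynomial.aeval (Matrix.diagonalAlgHom ℚ _) _ = _
  rw [Polynomial.aeval_algHom_apply]
  change _ • Matrix.diagonal _ = _
  rw [← Matrix.diagonal_smul]
  congr 1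
  funext x
  rw [Pi.smul_apply, Polynomial.aeval_fn_apply, Polynomial.coe_aeval_eq_eval,
    descPochhammer_eval_eq_descFactorial, Nat.descFactorial_eq_factorial_mul_choose, smul_eq_mul,
    Nat.cast_mul, inv_mul_cancel_left₀ (by exact_mod_cast b.factorial_ne_zero)]

end Representation

/-! ### Integrality and invariance under permutations of the factors -/

section Integrality

variable {n r : ℕ}

/-- The matrices with integral entries which commute with the permutations of the factors. -/
def integralInvariants (n r : ℕ) : Subring (Matrix (Fin r → Fin n) (Fin r → Fin n) ℚ) where
  carrier := {N | (∀ x y, N x y ∈ (Int.castRingHom ℚ).range) ∧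
    ∀ (s : Equiv.Perm (Fin r)) x y, N (x ∘ s) (y ∘ s) = N x y}
  zero_mem' := ⟨fun _ _ => zero_mem _, fun _ _ _ => rfl⟩
  one_mem' := by
    refine ⟨fun x y => ?_, fun s x y => ?_⟩
    · rw [Matrix.one_apply]
      split_ifs
      exacts [one_mem _, zero_mem _]
    · simp only [Matrix.one_apply, s.surjective.injective_comp_right.eq_iff]
  add_mem' := fun hN hN' => ⟨fun x y => add_mem (hN.1 x y) (hN'.1 x y), fun s x y => by
    rw [Matrix.add_apply, Matrix.add_apply, hN.2, hN'.2]⟩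
  neg_mem' := fun hN => ⟨fun x y => neg_mem (hN.1 x y), fun s x y => by
    rw [Matrix.neg_apply, Matrix.neg_apply, hN.2]⟩
  mul_mem' := by
    intro N N' hN hN'
    refine ⟨fun x y => ?_, fun s x y => ?_⟩
    · rw [Matrix.mul_apply]
      exact sum_mem fun z _ => mul_mem (hN.1 x z) (hN'.1 z y)
    · rw [Matrix.mul_apply, Matrix.mul_apply,
        ← (Equiv.arrowCongr s.symm (Equiv.refl (Fin n))).sum_comp]
      refine sum_congr rfl fun z _ => ?_
      change N (x ∘ s) (z ∘ s) * N' (z ∘ s) (y ∘ s) = _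
      rw [hN.2, hN'.2]

theorem wt_comp_perm (s : Equiv.Perm (Fin r)) (x : Fin r → Fin n) : wt (x ∘ s) = wt x := by
  funext j
  exact card_bij' (fun k _ => s k) (fun k _ => s.symm k) (by simp) (by simp) (by simp) (by simp)

theorem diagonal_wt_mem (c : (Fin n → ℕ) → ℚ) (hc : ∀ v, c v ∈ (Int.castRingHom ℚ).range) :
    Matrix.diagonal (fun x : Fin r → Fin n => c (wt x)) ∈ integralInvariants n r := by
  refine ⟨fun x y => ?_, fun s x y => ?_⟩
  · rw [Matrix.diagonal_apply]
    split_ifs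
    exacts [hc _, zero_mem _]
  · simp only [Matrix.diagonal_apply, s.surjective.injective_comp_right.eq_iff, wt_comp_perm]

theorem divMat_single_mem (i j : Fin n) (a : ℕ) :
    divMat r (Matrix.single i j 1 : Gl n) a ∈ integralInvariants n r := by
  refine ⟨fun x y => ?_, fun s x y => ?_⟩
  · rw [divMat, Matrix.sum_apply]
    refine sum_mem fun t _ => ?_
    rw [tensorMat_apply]
    refine prod_mem fun k _ => ?_
    by_cases h : k ∈ t
    · rw [if_pos h, Matrix.single_apply]
      split_ifs
      exacts [one_mem _, zero_mem _]
    · rw [if_neg h, Matrix.one_apply]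
      split_ifs
      exacts [one_mem _, zero_mem _]
  · rw [divMat, Matrix.sum_apply, Matrix.sum_apply]
    -- Permuting positions only permutes the subsets indexing the sum.
    refine sum_equiv s.finsetCongr (fun t => by simp [mem_powersetCard]) fun t _ => ?_
    rw [tensorMat_apply, tensorMat_apply]
    exact Fintype.prod_equiv s _ _ fun k => by
      have h : s k ∈ s.finsetCongr t ↔ k ∈ t := mem_map' s.toEmbedding
      simp only [h, Function.comp_apply]

theorem matRep_mem_integralInvariants {u : U n} (hu : u ∈ UZ n) :
    matRep n r u ∈ integralInvariants n r := by
  suffices UZ n ≤ (integralInvariants n r).comap (matRep n r : U n →+* _) from this hu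
  rw [UZ, Subring.closure_le]
  rintro _ ((⟨i, j, a, hij, rfl⟩ | ⟨i, b, rfl⟩) | ⟨i, j, a, hij, rfl⟩)
  · change matRep n r (divPow (e j i) a) ∈ integralInvariants n r
    rw [matRep_divPow (by rintro rfl; omega)]
    exact divMat_single_mem _ _ _
  · change matRep n r (binom (H i) b) ∈ integralInvariants n r
    rw [matRep_binom]
    exact diagonal_wt_mem (fun v => ((v i).choose b : ℚ)) fun v => ⟨(v i).choose b, by simp⟩
  · change matRep n r (divPow (e i j) a) ∈ integralInvariants n r
    rw [matRep_divPow (by rintro rfl; omega)]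
    exact divMat_single_mem _ _ _

end Integrality

/-! ### Non-simple root vectors via generating functions and commutators -/

section Coefficients

variable {n r : ℕ} {τ : Type*}

open MvPolynomial

theorem map_coeff_mul {I : Type*} [Fintype I] [DecidableEq τ]
    (N N' : Matrix I I (MvPolynomial τ ℚ)) (m : τ →₀ ℕ) :
    (N * N').map (coeff m) =
      ∑ p ∈ antidiagonal m, N.map (coeff p.1) * N'.map (coeff p.2) := by
  ext x y
  simp only [Matrix.map_apply, Matrix.mul_apply, Matrix.sum_apply, coeff_sum, coeff_mul]
  rw [sum_comm]

theorem map_coeff_tensorPow (M : Gl n) (d m : τ →₀ ℕ) (c : ℚ) :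
    (tensorPow r (1 + monomial d c • M.map C)).map (coeff m) =
      ∑ a ∈ range (r + 1), (coeff m (monomial d c ^ a)) • divMat r M a := by
  ext x y
  rw [Matrix.map_apply, tensorPow_one_add_smul, coeff_sum, Matrix.sum_apply]
  refine sum_congr rfl fun a _ => ?_
  rw [mul_comm, coeff_C_mul, Matrix.smul_apply, smul_eq_mul, mul_comm]

theorem divMat_eq_zero_of_lt {R : Type*} [CommRing R] (M : Matrix (Fin n) (Fin n) R) {a : ℕ}
    (h : r < a) : divMat r M a = 0 := by
  rw [divMat, powersetCard_eq_empty.2 (by simpa using h), sum_empty]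

theorem map_coeff_tensorPow_self (M : Gl n) {d : τ →₀ ℕ} (hd : d ≠ 0) (a : ℕ) :
    (tensorPow r (1 + monomial d (1 : ℚ) • M.map C)).map (coeff (a • d)) = divMat r M a := by
  classical
  rw [map_coeff_tensorPow]
  have key : ∀ b, coeff (a • d) (monomial d (1 : ℚ) ^ b) = if b = a then 1 else 0 := by
    intro b
    rw [monomial_pow, one_pow, coeff_monomial]
    obtain ⟨v, hv⟩ := Finsupp.ne_iff.1 hd
    refine if_congr ⟨fun h => ?_, fun h => by rw [h]⟩ rfl rfl
    -- Since `d ≠ 0`, the multiples `b • d` are distinct, so at most one term survives.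
    exact Nat.eq_of_mul_eq_mul_right (Nat.pos_of_ne_zero hv) (DFunLike.congr_fun h v)
  simp only [key, ite_smul, one_smul, zero_smul, sum_ite_eq']
  split_ifs with h
  · rfl
  · rw [divMat_eq_zero_of_lt]
    simpa using h

/-- An integer scalar `c` is enough: the commutator below uses only `c = ±1`. -/
theorem map_coeff_tensorPow_mem (S : Subring (Matrix (Fin r → Fin n) (Fin r → Fin n) ℚ))
    (M : Gl n) (hM : ∀ a, divMat r M a ∈ S) (d m : τ →₀ ℕ) (c : ℤ) :
    (tensorPow r (1 + monomial d (c : ℚ) • M.map C)).map (coeff m) ∈ S := by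
  classical
  rw [map_coeff_tensorPow]
  refine sum_mem fun a _ => ?_
  rw [monomial_pow, coeff_monomial]
  split_ifs
  · rw [← Int.cast_pow, Int.cast_smul_eq_zsmul]
    exact zsmul_mem (hM a) _
  · rw [zero_smul]
    exact zero_mem _

theorem map_coeff_mul_mem {I : Type*} [Fintype I] [DecidableEq I] (S : Subring (Matrix I I ℚ))
    {N N' : Matrix I I (MvPolynomial τ ℚ)} (hN : ∀ m, N.map (coeff m) ∈ S)
    (hN' : ∀ m, N'.map (coeff m) ∈ S) (m : τ →₀ ℕ) : (N * N').map (coeff m) ∈ S := by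
  classical
  rw [map_coeff_mul]
  exact sum_mem fun p _ => mul_mem (hN _) (hN' _)

/-- A group commutator, because `1 - a` and `1 - b` invert `1 + a` and `1 + b`. -/
theorem one_add_commutator {A : Type*} [Ring A] {a b : A} (ha : a * a = 0) (hb : b * b = 0)
    (hba : b * a = 0) : (1 + a) * (1 + b) * ((1 + -a) * (1 + -b)) = 1 + a * b := by
  have h1 : (1 + a) * (1 + b) = 1 + a + b + a * b := by noncomm_ring
  have h2 : (1 + -a) * (1 + -b) = 1 - a - b + a * b := by noncomm_ring
  have ha' : ∀ x, a * (a * x) = 0 := fun x => by rw [← mul_assoc, ha, zero_mul]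
  have hba' : ∀ x, b * (a * x) = 0 := fun x => by rw [← mul_assoc, hba, zero_mul]
  rw [h1, h2]
  simp only [add_mul, mul_add, mul_sub, mul_one, one_mul, mul_assoc, ha, hb, hba, ha', hba',
    mul_zero]
  abel

/-- The commutator of `1 + t₁ E_{ij}` and `1 + t₂ E_{jk}` is `1 + t₁ t₂ E_{ik}`. In its `r`-th
tensor power the coefficient of `(t₁ t₂)^a` is the required matrix, and each of the four factors has
all its coefficients in `S`. -/
theorem divMat_single_mem_of_trans
    (S : Subring (Matrix (Fin r → Fin n) (Fin r → Fin n) ℚ)) {i j k : Fin n}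
    (hij : i ≠ j) (hjk : j ≠ k) (hik : i ≠ k)
    (h1 : ∀ a, divMat r (Matrix.single i j 1 : Gl n) a ∈ S)
    (h2 : ∀ a, divMat r (Matrix.single j k 1 : Gl n) a ∈ S) (a : ℕ) :
    divMat r (Matrix.single i k 1 : Gl n) a ∈ S := by
  let d1 : Fin 2 →₀ ℕ := Finsupp.single 0 1
  let d2 : Fin 2 →₀ ℕ := Finsupp.single 1 1
  have hd : d1 + d2 ≠ 0 := fun h => by simpa [d1, d2] using DFunLike.congr_fun h 0
  have hneg : ∀ (d : Fin 2 →₀ ℕ) (M : Gl n), -(monomial d (1 : ℚ) • M.map (C (σ := Fin 2))) =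
      monomial d ((-1 : ℤ) : ℚ) • M.map C := by
    intro d M
    rw [← neg_smul, Int.cast_neg, Int.cast_one, map_neg]
  have hmul : ∀ (d d' : Fin 2 →₀ ℕ) (M M' : Gl n),
      (monomial d (1 : ℚ) • M.map (C (σ := Fin 2))) * (monomial d' (1 : ℚ) • M'.map C) =
        monomial (d + d') (1 : ℚ) • (M * M').map C := by
    intro d d' M M'
    rw [smul_mul_smul_comm, monomial_mul, one_mul, ← Matrix.map_mul]
  have key := one_add_commutator
    (a := monomial d1 (1 : ℚ) • (Matrix.single i j 1 : Gl n).map (C (σ := Fin 2)))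
    (b := monomial d2 (1 : ℚ) • (Matrix.single j k 1 : Gl n).map (C (σ := Fin 2)))
    (by rw [hmul, single_mul_self hij]; simp) (by rw [hmul, single_mul_self hjk]; simp)
    (by rw [hmul, Matrix.single_mul_single_of_ne _ _ _ _ hik.symm]; simp)
  rw [hneg, hneg, hmul, Matrix.single_mul_single_same, mul_one] at key
  rw [← map_coeff_tensorPow_self _ hd a, ← key, map_mul, map_mul, map_mul]
  have h1' := fun c m => map_coeff_tensorPow_mem S _ h1 d1 m c
  have h2' := fun c m => map_coeff_tensorPow_mem S _ h2 d2 m c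
  have h1'' := h1' 1
  have h2'' := h2' 1
  rw [Int.cast_one] at h1'' h2''
  exact map_coeff_mul_mem S (map_coeff_mul_mem S h1'' h2'')
    (map_coeff_mul_mem S (h1' (-1)) (h2' (-1))) _

theorem divMat_single_mem_map_UZ {i j : Fin n} (hij : i ≠ j) (a : ℕ) :
    divMat r (Matrix.single i j 1 : Gl n) a ∈ (UZ n).map (matRep n r : U n →+* _) := by
  have base : ∀ i j : Fin n, (i : ℕ) + 1 = j → ∀ a,
      divMat r (Matrix.single i j 1 : Gl n) a ∈ (UZ n).map (matRep n r : U n →+* _) ∧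
      divMat r (Matrix.single j i 1 : Gl n) a ∈ (UZ n).map (matRep n r : U n →+* _) := by
    intro i j h a
    have hne : i ≠ j := by rintro rfl; omega
    exact ⟨⟨divPow (e i j) a, Subring.subset_closure (Or.inr ⟨i, j, a, h, rfl⟩),
        matRep_divPow hne a⟩,
      ⟨divPow (f i j) a, Subring.subset_closure (Or.inl (Or.inl ⟨i, j, a, h, rfl⟩)),
        matRep_divPow hne.symm a⟩⟩
  -- Induction on the height of the root, which is `d + 1`; positive and negative roots go together.
  have key : ∀ (d : ℕ) (i j : Fin n), (i : ℕ) + (d + 1) = j → ∀ a,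
      divMat r (Matrix.single i j 1 : Gl n) a ∈ (UZ n).map (matRep n r : U n →+* _) ∧
      divMat r (Matrix.single j i 1 : Gl n) a ∈ (UZ n).map (matRep n r : U n →+* _) := by
    intro d
    induction d with
    | zero => exact base
    | succ d ih =>
      intro i k h a
      obtain ⟨j, hj⟩ : ∃ j : Fin n, (j : ℕ) = i + (d + 1) := ⟨⟨i + (d + 1), by omega⟩, rfl⟩
      have hij : i ≠ j := by rintro rfl; omega
      have hjk : j ≠ k := by rintro rfl; omega
      have hik : i ≠ k := by rintro rfl; omega
      have h1 := ih i j hj.symm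
      have h2 := base j k (by omega)
      exact ⟨divMat_single_mem_of_trans _ hij hjk hik (fun a => (h1 a).1) (fun a => (h2 a).1) a,
        divMat_single_mem_of_trans _ hjk.symm hij.symm hik.symm (fun a => (h2 a).2)
          (fun a => (h1 a).2) a⟩
  rcases lt_or_gt_of_ne hij with h | h
  · exact (key (j - i - 1) i j (by have : (i : ℕ) < j := h; omega) a).1
  · exact (key (i - j - 1) j i (by have : (j : ℕ) < i := h; omega) a).2

end Coefficients

/-! ### Lowest-degree terms of the generic product of elementary matrices -/

section Triangularity

open MvPolynomial

variable {n r : ℕ}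

/-- The product of the generic elementary matrices `1 + t_{ij} E_{ij}`, over a list of pairs. -/
def elemProd (l : List (Fin n × Fin n)) :
    Matrix (Fin n) (Fin n) (MvPolynomial (Fin n × Fin n) ℚ) :=
  (l.map fun p => 1 + monomial (Finsupp.single p 1) (1 : ℚ) •
    (Matrix.single p.1 p.2 1 : Gl n).map C).prod

/-- Without repetitions each variable occurs in a single factor, so a monomial splits among the
factors in at most one way. -/
theorem map_coeff_tensorPow_elemProd {l : List (Fin n × Fin n)} (hl : l.Nodup)
    (m : Fin n × Fin n →₀ ℕ) :
    (tensorPow r (elemProd l)).map (coeff m) = if ∀ p ∉ l, m p = 0 then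
      (l.map fun p => divMat r (Matrix.single p.1 p.2 1 : Gl n) (m p)).prod else 0 := by
  classical
  induction l generalizing m with
  | nil =>
    have : (∀ p, m p = 0) ↔ 0 = m := by rw [eq_comm, DFunLike.ext_iff]; rfl
    ext x y
    simp only [elemProd, List.map_nil, List.prod_nil, map_one, Matrix.map_apply, Matrix.one_apply,
      List.not_mem_nil, not_false_eq_true, true_imp_iff, this]
    split_ifs <;> simp_all [coeff_one, Matrix.one_apply]
  | cons q l ih =>
    obtain ⟨hq, hl'⟩ := List.nodup_cons.1 hl
    have hfirst : ∀ u, (tensorPow r (1 + monomial (Finsupp.single q 1) (1 : ℚ) •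
        (Matrix.single q.1 q.2 1 : Gl n).map C)).map (coeff u) =
        if u = Finsupp.single q (u q) then
          divMat r (Matrix.single q.1 q.2 1 : Gl n) (u q) else 0 := by
      intro u
      split_ifs with h
      · conv_lhs => rw [h, ← mul_one (u q), ← smul_eq_mul, ← Finsupp.smul_single]
        exact map_coeff_tensorPow_self _ (by simp) _
      · rw [map_coeff_tensorPow]
        refine sum_eq_zero fun a _ => ?_
        rw [monomial_pow, coeff_monomial, if_neg, zero_smul]
        rintro rfl
        simp at h
    have hsplit : elemProd (q :: l) = (1 + monomial (Finsupp.single q 1) (1 : ℚ) •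
        (Matrix.single q.1 q.2 1 : Gl n).map C) * elemProd l := by
      rw [elemProd, List.map_cons, List.prod_cons]; rfl
    rw [hsplit, map_mul, map_coeff_mul,
      sum_eq_single (Finsupp.single q (m q), m.erase q)]
    · rw [hfirst, ih hl', Finsupp.single_eq_same, if_pos rfl, List.map_cons, List.prod_cons]
      have hiff : (∀ p ∉ l, m.erase q p = 0) ↔ ∀ p ∉ q :: l, m p = 0 := by
        constructor
        · intro h p hp
          rw [List.mem_cons, not_or] at hp
          rw [← h p hp.2, Finsupp.erase_ne hp.1]
        · intro h p hp
          by_cases hpq : p = q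
          · rw [hpq, Finsupp.erase_same]
          · rw [Finsupp.erase_ne hpq, h p (by simp [hpq, hp])]
      have hmap : (l.map fun p => divMat r (Matrix.single p.1 p.2 1 : Gl n) (m.erase q p)) =
          l.map fun p => divMat r (Matrix.single p.1 p.2 1 : Gl n) (m p) :=
        List.map_congr_left fun p hp => by
          rw [Finsupp.erase_ne (by rintro rfl; exact hq hp)]
      simp only [hiff, hmap, mul_ite, mul_zero]
    · rintro ⟨u, v⟩ huv hne
      rw [HasAntidiagonal.mem_antidiagonal] at huv
      dsimp only at huv hne ⊢
      rw [hfirst, ih hl']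
      split_ifs with h1 h2
      · exfalso
        have hvq : v q = 0 := h2 q hq
        have huq : u q = m q := by
          rw [← huv, Finsupp.add_apply, hvq, add_zero]
        apply hne
        rw [huq] at h1
        refine Prod.ext h1 ?_
        ext p
        by_cases hp : p = q
        · rw [hp, hvq, Finsupp.erase_same]
        · rw [Finsupp.erase_ne hp, ← huv, Finsupp.add_apply, h1, Finsupp.single_eq_of_ne hp,
            zero_add]
      · exact mul_zero _
      · exact zero_mul _
      · exact zero_mul _
    · intro h
      exact absurd (HasAntidiagonal.mem_antidiagonal.2 (Finsupp.single_add_erase q m)) h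

/-- To first order the product does not see the order of its factors; this is why the orderings in
the theorem may be arbitrary. -/
theorem elemProd_apply_sub_mem {l : List (Fin n × Fin n)} (hl : l.Nodup) (i j : Fin n) :
    elemProd l i j - ((1 : Matrix (Fin n) (Fin n) (MvPolynomial (Fin n × Fin n) ℚ)) i j +
      if (i, j) ∈ l then X (i, j) else 0) ∈ idealOfVars (Fin n × Fin n) ℚ ^ 2 := by
  have hX : ∀ p, (X p : MvPolynomial (Fin n × Fin n) ℚ) ∈ idealOfVars (Fin n × Fin n) ℚ :=
    fun p => Ideal.subset_span ⟨p, rfl⟩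
  induction l generalizing i j with
  | nil => simp [elemProd]
  | cons q l ih =>
    obtain ⟨hq, hl'⟩ := List.nodup_cons.1 hl
    have hsplit : elemProd (q :: l) i j = elemProd l i j +
        if i = q.1 then X q * elemProd l q.2 j else 0 := by
      have h1 : elemProd (q :: l) = (1 + monomial (Finsupp.single q 1) (1 : ℚ) •
        (Matrix.single q.1 q.2 1 : Gl n).map C) * elemProd l := by
        rw [elemProd, List.map_cons, List.prod_cons]; rfl
      rw [h1, add_mul, one_mul, Matrix.add_apply, Matrix.smul_mul, Matrix.smul_apply,
        Matrix.map_single _ _ _ (C (σ := Fin n × Fin n)), C_1]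
      split_ifs with h
      · rw [h, Matrix.single_mul_apply_same, one_mul]; rfl
      · rw [Matrix.single_mul_apply_of_ne _ _ _ _ _ h, smul_zero]
    have hmem : elemProd l q.2 j - (1 : Matrix (Fin n) (Fin n) _) q.2 j ∈
        idealOfVars (Fin n × Fin n) ℚ := by
      have h2 := Ideal.pow_le_self two_ne_zero (ih hl' q.2 j)
      have h3 : (if (q.2, j) ∈ l then X (q.2, j) else 0) ∈ idealOfVars (Fin n × Fin n) ℚ := by
        split_ifs
        exacts [hX _, zero_mem _]
      convert add_mem h2 h3 using 1
      ring
    have hmem2 : X q * (elemProd l q.2 j - (1 : Matrix (Fin n) (Fin n) _) q.2 j) ∈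
        idealOfVars (Fin n × Fin n) ℚ ^ 2 := by
      rw [pow_two]
      exact Ideal.mul_mem_mul (hX q) hmem
    rw [hsplit]
    by_cases hi : i = q.1
    · by_cases hj : q.2 = j
      · have hij : (i, j) = q := Prod.ext hi hj.symm
        rw [hij, if_pos hi, if_pos List.mem_cons_self]
        have h4 := ih hl' i j
        rw [hij, if_neg hq] at h4
        rw [hj, Matrix.one_apply_eq] at hmem2
        rw [hj]
        convert add_mem h4 hmem2 using 1
        ring
      · have hij : (i, j) ≠ q := fun h => hj (by rw [← h])
        rw [Matrix.one_apply_ne hj] at hmem2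
        rw [if_pos hi]
        simp only [List.mem_cons, hij, false_or]
        convert add_mem (ih hl' i j) hmem2 using 1
        ring
    · have hij : (i, j) ≠ q := fun h => hi (by rw [← h])
      rw [if_neg hi, add_zero]
      simp only [List.mem_cons, hij, false_or]
      exact ih hl' i j

/-- Leading terms multiply in the `I`-adic filtration. -/
theorem prod_sub_prod_mem_pow {A K : Type*} [CommRing A] (I : Ideal A) (a b : K → A) (w : K → ℕ)
    (hb : ∀ k, b k ∈ I ^ w k) (hab : ∀ k, a k - b k ∈ I ^ (w k + 1)) (s : Finset K) :
    ∏ k ∈ s, a k - ∏ k ∈ s, b k ∈ I ^ (∑ k ∈ s, w k + 1) := by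
  classical
  induction s using Finset.induction_on with
  | empty => simp
  | insert k s hk ih =>
    rw [prod_insert hk, prod_insert hk, sum_insert hk]
    have ha : a k ∈ I ^ w k := by
      have := add_mem (Ideal.pow_le_pow_right (Nat.le_succ _) (hab k)) (hb k)
      rwa [sub_add_cancel] at this
    have hB : ∏ k ∈ s, b k ∈ I ^ ∑ k ∈ s, w k := by
      rw [← prod_pow_eq_pow_sum]
      exact Ideal.prod_mem_prod fun k _ => hb k
    have h1 := Ideal.mul_mem_mul ha ih
    have h2 := Ideal.mul_mem_mul (hab k) hB
    rw [← pow_add] at h1 h2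
    rw [← add_assoc] at h1
    rw [add_right_comm] at h2
    convert add_mem h1 h2 using 1
    ring

/-- The number of positions in which each pair of values occurs in a pair of multi-indices. -/
def pairCount (x y : Fin r → Fin n) : Matrix (Fin n) (Fin n) ℕ :=
  Matrix.of fun i j => #{k | x k = i ∧ y k = j}

/-- The off-diagonal part of a matrix of natural numbers, as a multidegree. -/
def offDiagPart (A : Matrix (Fin n) (Fin n) ℕ) : Fin n × Fin n →₀ ℕ :=
  Finsupp.equivFunOnFinite.symm fun p => if p.1 = p.2 then 0 else A p.1 p.2

theorem offDiagPart_apply (A : Matrix (Fin n) (Fin n) ℕ) (p : Fin n × Fin n) :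
    offDiagPart A p = if p.1 = p.2 then 0 else A p.1 p.2 := rfl

theorem offDiagPart_pairCount (x y : Fin r → Fin n) :
    offDiagPart (pairCount x y) =
      ∑ k, if x k = y k then 0 else Finsupp.single (x k, y k) 1 := by
  ext ⟨i, j⟩
  rw [offDiagPart_apply, Finsupp.finsetSum_apply]
  simp only [pairCount, Matrix.of_apply]
  split_ifs with h
  · symm
    refine sum_eq_zero fun k _ => ?_
    split_ifs with hk
    · rfl
    · rw [Finsupp.single_apply, if_neg]
      rintro ⟨⟩
      exact hk h
  · rw [card_filter]
    refine sum_congr rfl fun k _ => ?_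
    by_cases hk : x k = y k
    · rw [if_pos hk, if_neg]
      · rfl
      · rintro ⟨rfl, rfl⟩
        exact h hk
    · rw [if_neg hk, Finsupp.single_apply]
      simp only [Prod.mk.injEq]

theorem coeff_tensorPow_elemProd_apply {l : List (Fin n × Fin n)} (hl : l.Nodup)
    (hmem : ∀ p : Fin n × Fin n, p ∈ l ↔ p.1 ≠ p.2) (x y : Fin r → Fin n)
    (m : Fin n × Fin n →₀ ℕ) (hm : m.degree ≤ (offDiagPart (pairCount x y)).degree) :
    coeff m (tensorPow r (elemProd l) x y) = if m = offDiagPart (pairCount x y) then 1 else 0 := by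
  classical
  let I := idealOfVars (Fin n × Fin n) ℚ
  -- The leading term of the `k`-th factor: `1` on the diagonal, the variable `t_{x_k y_k}` off it.
  let b : Fin r → MvPolynomial (Fin n × Fin n) ℚ := fun k =>
    monomial (if x k = y k then 0 else Finsupp.single (x k, y k) 1) 1
  let w : Fin r → ℕ := fun k => if x k = y k then 0 else 1
  have hb : ∀ k, b k ∈ I ^ w k := by
    intro k
    by_cases h : x k = y k
    · simp [w, h]
    · simp only [b, w, h, if_false, pow_one]
      exact Ideal.subset_span ⟨(x k, y k), rfl⟩
  have hab : ∀ k, elemProd l (x k) (y k) - b k ∈ I ^ (w k + 1) := by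
    intro k
    have h2 := elemProd_apply_sub_mem hl (x k) (y k)
    by_cases h : x k = y k
    · have h3 : (x k, y k) ∉ l := fun h' => (hmem _).1 h' h
      rw [if_neg h3, h, Matrix.one_apply_eq, add_zero] at h2
      simp only [b, w, h, if_true]
      exact Ideal.pow_le_pow_right (by norm_num) h2
    · rw [if_pos ((hmem (x k, y k)).2 h), Matrix.one_apply_ne h, zero_add] at h2
      simp only [b, w, h, if_false]
      exact h2
  have hdeg : ∑ k, w k = (offDiagPart (pairCount x y)).degree := by
    rw [offDiagPart_pairCount, map_sum]
    refine sum_congr rfl fun k _ => ?_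
    by_cases h : x k = y k <;> simp [w, h]
  have hprod : ∏ k, b k = monomial (offDiagPart (pairCount x y)) 1 := by
    rw [offDiagPart_pairCount, monomial_sum_one]
  have key := prod_sub_prod_mem_pow I _ b w hb hab univ
  rw [hdeg, hprod] at key
  have h0 := (mem_pow_idealOfVars_iff' _ _).1 key m (Nat.lt_succ_of_le hm)
  rw [coeff_sub, sub_eq_zero, coeff_monomial] at h0
  rw [tensorPow_apply, h0]
  simp only [eq_comm]

end Triangularity

/-- The coordinate matrix of `w` has determinant one, so the images of `w` form a basis of `ℤ^ι`; an
injective `κ` with integral values is then an isomorphism onto `ℤ^ι`. -/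
theorem exists_basis_of_unitriangular {ι M : Type*} [Finite ι] [DecidableEq ι] [AddCommMonoid M]
    [Module ℤ M] (κ : M →ₗ[ℤ] (ι → ℚ)) (hinj : Function.Injective κ)
    (hint : ∀ m i, κ m i ∈ (Int.castRingHom ℚ).range) (deg : ι → ℕ) (w : ι → M)
    (hw : ∀ i j, deg i ≤ deg j → κ (w i) j = if i = j then 1 else 0) :
    ∃ b : Module.Basis ι ℤ M, ∀ i, b i = w i := by
  have := Fintype.ofFinite ι
  choose z hz using hint
  simp only [eq_intCast] at hz
  let κ' : M →ₗ[ℤ] (ι → ℤ) :=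
    { toFun := z
      map_add' := fun a b => by
        funext i
        have := hz (a + b) i
        rw [map_add, Pi.add_apply, ← hz, ← hz] at this
        exact_mod_cast this
      map_smul' := fun c a => by
        funext i
        have := hz (c • a) i
        rw [map_smul, Pi.smul_apply, ← hz, zsmul_eq_mul] at this
        exact_mod_cast this }
  have hinj' : Function.Injective κ' := fun a b h => hinj <| by
    funext i
    rw [← hz, ← hz]
    exact congrArg _ (congrFun h i)
  let N : Matrix ι ι ℤ := Matrix.of fun i j => κ' (w i) j
  have hN : ∀ i j, deg i ≤ deg j → N i j = if i = j then 1 else 0 := by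
    intro i j h
    have := (hz (w i) j).trans (hw i j h)
    change z (w i) j = _
    split_ifs at this ⊢ <;> exact_mod_cast this
  have hdet : N.det = 1 := by
    -- Entries vanish when the column has larger degree than the row, hence the reversed order; the
    -- diagonal blocks are identities.
    have htri : N.BlockTriangular fun i => OrderDual.toDual (deg i) := by
      intro i j h
      have h' : deg i < deg j := h
      rw [hN i j h'.le, if_neg (by rintro rfl; exact lt_irrefl _ h')]
    rw [htri.det]
    refine prod_eq_one fun a _ => ?_
    have : N.toSquareBlock (fun i => OrderDual.toDual (deg i)) a = 1 := by
      ext ⟨i, hi⟩ ⟨j, hj⟩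
      have hij : deg i = deg j := OrderDual.toDual.injective (hi.trans hj.symm)
      rw [Matrix.toSquareBlock_def, Matrix.of_apply, hN i j hij.le, Matrix.one_apply]
      simp only [Subtype.mk.injEq]
    rw [this, Matrix.det_one]
  have hLI : LinearIndependent ℤ w := by
    refine LinearIndependent.of_comp κ' ?_
    exact Matrix.linearIndependent_rows_of_det_ne_zero (A := N) (by rw [hdet]; exact one_ne_zero)
  have hspan : ⊤ ≤ Submodule.span ℤ (Set.range w) := by
    intro m _
    have hm : m = ∑ i, (κ' m ᵥ* N⁻¹) i • w i := by
      apply hinj'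
      have hsum : κ' (∑ i, (κ' m ᵥ* N⁻¹) i • w i) = (κ' m ᵥ* N⁻¹) ᵥ* N := by
        funext j
        rw [map_sum, Finset.sum_apply]
        simp only [map_smul, Pi.smul_apply, smul_eq_mul]
        rfl
      rw [hsum, Matrix.vecMul_vecMul, Matrix.nonsing_inv_mul _ (by rw [hdet]; exact isUnit_one),
        Matrix.vecMul_one]
    rw [hm]
    exact sum_mem fun i _ => Submodule.smul_mem _ _ (Submodule.subset_span ⟨i, rfl⟩)
  exact ⟨Module.Basis.mk hLI hspan, fun i => Module.Basis.mk_apply hLI hspan i⟩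

/-! ### Orbits of pairs of multi-indices and matrices with given margins -/

section Orbits

variable {n r : ℕ}

theorem sum_pairCount_row (x y : Fin r → Fin n) (i : Fin n) :
    ∑ j, pairCount x y i j = wt x i := by
  simp only [pairCount, Matrix.of_apply, wt]
  rw [card_eq_sum_card_fiberwise (f := y) (t := univ) (by simp)]
  simp only [filter_filter]

theorem sum_pairCount_col (x y : Fin r → Fin n) (j : Fin n) :
    ∑ i, pairCount x y i j = wt y j := by
  simp only [pairCount, Matrix.of_apply, wt]
  rw [card_eq_sum_card_fiberwise (f := x) (t := univ) (by simp)]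
  simp only [filter_filter, and_comm]

/-- The fibres of `k ↦ (x k, y k)` and `k ↦ (x' k, y' k)` have equal sizes, so bijections between
them glue to a permutation. -/
theorem exists_perm_of_pairCount_eq {x y x' y' : Fin r → Fin n}
    (h : pairCount x y = pairCount x' y') :
    ∃ s : Equiv.Perm (Fin r), x = x' ∘ s ∧ y = y' ∘ s := by
  have hcard : ∀ p : Fin n × Fin n,
      Fintype.card {k // (x k, y k) = p} = Fintype.card {k // (x' k, y' k) = p} := by
    intro p
    have := congrFun (congrFun h p.1) p.2
    simp only [pairCount, Matrix.of_apply] at this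
    simpa only [Fintype.card_subtype, Prod.ext_iff] using this
  let s : Equiv.Perm (Fin r) := Equiv.ofFiberEquiv (f := fun k => (x k, y k))
    (g := fun k => (x' k, y' k)) fun p => Fintype.equivOfCardEq (hcard p)
  have hs : ∀ k, (x' (s k), y' (s k)) = (x k, y k) := fun k =>
    Equiv.ofFiberEquiv_map (f := fun k => (x k, y k)) (g := fun k => (x' k, y' k)) _ k
  exact ⟨s, funext fun k => (congrArg Prod.fst (hs k)).symm,
    funext fun k => (congrArg Prod.snd (hs k)).symm⟩

theorem exists_pairCount_eq (A : Matrix (Fin n) (Fin n) ℕ) (hA : ∑ i, ∑ j, A i j = r) :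
    ∃ x y : Fin r → Fin n, pairCount x y = A := by
  have hcard : Fintype.card (Fin r) = Fintype.card (Σ p : Fin n × Fin n, Fin (A p.1 p.2)) := by
    simp [Fintype.sum_prod_type, hA]
  let s := Fintype.equivOfCardEq hcard
  refine ⟨fun k => (s k).1.1, fun k => (s k).1.2, ?_⟩
  ext i j
  rw [pairCount, Matrix.of_apply, ← Fintype.card_subtype, ← Fintype.card_fin (A i j)]
  refine Fintype.card_congr ((s.subtypeEquiv (q := fun t => t.1 = (i, j)) fun k => ?_).trans
    (Equiv.sigmaSubtype (i, j)))
  rw [Prod.ext_iff]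

/-- The row sums recover the diagonal. -/
theorem offDiagPart_injOn {lam mu : Fin n → ℕ} {A B : Matrix (Fin n) (Fin n) ℕ}
    (hA : A ∈ Theta lam mu) (hB : B ∈ Theta lam mu) (h : offDiagPart A = offDiagPart B) :
    A = B := by
  have hne : ∀ i j, i ≠ j → A i j = B i j := by
    intro i j hij
    have := DFunLike.congr_fun h (i, j)
    simpa only [offDiagPart_apply, hij, if_false] using this
  ext i j
  by_cases hij : i = j
  · subst hij
    have h1 := (hA.1 i).trans (hB.1 i).symm
    rw [← add_sum_erase _ _ (mem_univ i), ← add_sum_erase _ (B i) (mem_univ i),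
      sum_congr rfl fun j hj => hne i j (ne_of_mem_erase hj).symm] at h1
    exact Nat.add_right_cancel h1
  · exact hne i j hij

end Orbits

/-! ### Coordinates on the weight pieces and the two bases -/

section Basis

variable {n r : ℕ}

theorem toMatrix_idem (lam : Fin n → ℕ) :
    LinearMap.toMatrixAlgEquiv (stdBasis n r) (idem lam) =
      Matrix.diagonal fun x => if wt x = lam then (1 : ℚ) else 0 := by
  ext x y
  rw [LinearMap.toMatrixAlgEquiv_apply, idem, Module.Basis.constr_basis, Matrix.diagonal_apply]
  by_cases hxy : x = y
  · subst hxy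
    rw [if_pos rfl]
    split_ifs <;> simp
  · rw [if_neg hxy]
    split_ifs
    · rw [Module.Basis.repr_self, Finsupp.single_eq_of_ne hxy]
    · simp

theorem toMatrix_idem_mul_mul_idem (lam mu : Fin n → ℕ) (u : U n) (x y : Fin r → Fin n) :
    LinearMap.toMatrixAlgEquiv (stdBasis n r) (idem lam * dRho n r u * idem mu) x y =
      if wt x = lam ∧ wt y = mu then matRep n r u x y else 0 := by
  rw [map_mul, map_mul, toMatrix_idem, toMatrix_idem, Matrix.mul_diagonal, Matrix.diagonal_mul,
    matRep_apply]
  by_cases h1 : wt x = lam <;> by_cases h2 : wt y = mu <;> simp [h1, h2]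

/-- Any ordering `l` of all off-diagonal pairs is allowed, so both halves of the theorem are
instances. -/
theorem exists_basis_of_matRep_eq (lam mu : Fin n → ℕ) (hlam : lam ∈ Comps n r)
    {l : List (Fin n × Fin n)} (hl : l.Nodup) (hmem : ∀ p : Fin n × Fin n, p ∈ l ↔ p.1 ≠ p.2)
    (g : Matrix (Fin n) (Fin n) ℕ → U n)
    (hg : ∀ A, matRep n r (g A) =
      (l.map fun p => divMat r (Matrix.single p.1 p.2 1 : Gl n) (offDiagPart A p)).prod) :
    ∃ b : Module.Basis (Theta lam mu) ℤ (SZweight n r lam mu),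
      ∀ A : Theta lam mu, (b A : Module.End ℚ (TensorSpace n r)) =
        idem lam * dRho n r (g A) * idem mu := by
  classical
  let T := LinearMap.toMatrixAlgEquiv (stdBasis n r)
  have hsum : ∀ A : Theta lam mu, ∑ i, ∑ j, A.1 i j = r := fun A => by
    rw [sum_congr rfl fun i _ => A.2.1 i]
    exact hlam
  choose x y hxy using fun A : Theta lam mu => exists_pairCount_eq A.1 (hsum A)
  have hfin : Finite (Theta lam mu) := by
    refine Finite.of_injective (fun A => (x A, y A)) fun A B h => Subtype.ext ?_
    rw [Prod.ext_iff] at h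
    dsimp only at h
    rw [← hxy A, ← hxy B, h.1, h.2]
  have hwx : ∀ A, wt (x A) = lam := fun A => by
    funext i
    rw [← sum_pairCount_row (x A) (y A), hxy]
    exact A.2.1 i
  have hwy : ∀ A, wt (y A) = mu := fun A => by
    funext j
    rw [← sum_pairCount_col (x A) (y A), hxy]
    exact A.2.2 j
  have hgmem : ∀ A, dRho n r (g A) ∈ SZ n r := by
    intro A
    have h1 : matRep n r (g A) ∈ (UZ n).map (matRep n r : U n →+* _) := by
      rw [hg]
      refine list_prod_mem fun N hN => ?_
      obtain ⟨p, hp, rfl⟩ := List.mem_map.1 hN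
      exact divMat_single_mem_map_UZ ((hmem p).1 hp) _
    obtain ⟨u, hu, hug⟩ := h1
    exact ⟨u, hu, T.injective hug⟩
  have hS : ∀ s : SZweight n r lam mu, ∃ u ∈ UZ n,
      (s : Module.End ℚ (TensorSpace n r)) = idem lam * dRho n r u * idem mu := by
    rintro ⟨_, _, ⟨u, hu, rfl⟩, rfl⟩
    exact ⟨u, hu, rfl⟩
  -- One matrix entry for each orbit, taken at the chosen representative.
  let κ : SZweight n r lam mu →ₗ[ℤ] (Theta lam mu → ℚ) :=
    { toFun := fun s A => T s (x A) (y A)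
      map_add' := fun s t => by
        funext A
        simp
      map_smul' := fun c s => by
        funext A
        change T (c • (s : Module.End ℚ (TensorSpace n r))) (x A) (y A) = _
        rw [map_zsmul]
        rfl }
  have hκ : ∀ (s : SZweight n r lam mu) (A : Theta lam mu), κ s A = T s (x A) (y A) :=
    fun _ _ => rfl
  have hκu : ∀ (s : SZweight n r lam mu) (u : U n) (A : Theta lam mu),
      (s : Module.End ℚ (TensorSpace n r)) = idem lam * dRho n r u * idem mu →
      κ s A = matRep n r u (x A) (y A) := by
    intro s u A h
    rw [hκ, h]
    exact (toMatrix_idem_mul_mul_idem lam mu u _ _).trans (if_pos ⟨hwx A, hwy A⟩)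
  have hinj : Function.Injective κ := by
    intro s t hst
    obtain ⟨u, hu, hsu⟩ := hS s
    obtain ⟨v, hv, htv⟩ := hS t
    refine Subtype.ext (T.injective ?_)
    ext x' y'
    rw [hsu, htv]
    refine (toMatrix_idem_mul_mul_idem lam mu u _ _).trans
      (Eq.trans ?_ (toMatrix_idem_mul_mul_idem lam mu v _ _).symm)
    split_ifs with hw
    · obtain ⟨hw1, hw2⟩ := hw
      let A : Theta lam mu := ⟨pairCount x' y', fun i => by rw [sum_pairCount_row, hw1],
        fun j => by rw [sum_pairCount_col, hw2]⟩
      -- Every entry within the weights is moved by a permutation to a representative, where the two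
      -- matrices agree.
      obtain ⟨p, hp1, hp2⟩ := exists_perm_of_pairCount_eq (hxy A).symm
      rw [hp1, hp2, (matRep_mem_integralInvariants hu).2, (matRep_mem_integralInvariants hv).2,
        ← hκu s u A hsu, ← hκu t v A htv, hst]
    · rfl
  have hint : ∀ s A, κ s A ∈ (Int.castRingHom ℚ).range := by
    intro s A
    obtain ⟨u, hu, hsu⟩ := hS s
    rw [hκu s u A hsu]
    exact (matRep_mem_integralInvariants hu).1 _ _
  let w : Theta lam mu → SZweight n r lam mu := fun A =>
    ⟨idem lam * dRho n r (g A) * idem mu, dRho n r (g A), hgmem A, rfl⟩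
  obtain ⟨b, hb⟩ := exists_basis_of_unitriangular κ hinj hint
    (fun A => (offDiagPart A.1).degree) w fun A B hAB => by
      have hA0 : ∀ p ∉ l, offDiagPart A.1 p = 0 := by
        intro p hp
        rw [offDiagPart_apply, if_pos (by_contra fun h => hp ((hmem p).2 h))]
      have h1 := map_coeff_tensorPow_elemProd (r := r) hl (offDiagPart A.1)
      rw [if_pos hA0, ← hg] at h1
      rw [hκu (w A) (g A) B rfl, ← h1, Matrix.map_apply,
        coeff_tensorPow_elemProd_apply hl hmem _ _ _ (by rwa [hxy]), hxy]
      refine if_congr ⟨fun h => Subtype.ext (offDiagPart_injOn A.2 B.2 h), fun h => by rw [h]⟩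
        rfl rfl
  exact ⟨b, fun A => by rw [hb]⟩

theorem matRep_eProd {l : List (Fin n × Fin n)} (hl : IsOrdering l)
    (A : Matrix (Fin n) (Fin n) ℕ) : matRep n r (eProd l A) =
      (l.map fun p => divMat r (Matrix.single p.1 p.2 1 : Gl n) (offDiagPart A p)).prod := by
  rw [eProd, map_list_prod, List.map_map]
  refine congrArg _ (List.map_congr_left fun p hp => ?_)
  have h := ((hl.2 p).1 hp).ne
  rw [Function.comp_apply, matRep_divPow h, offDiagPart_apply, if_neg h]

theorem matRep_fProd {l : List (Fin n × Fin n)} (hl : IsOrdering l)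
    (A : Matrix (Fin n) (Fin n) ℕ) : matRep n r (fProd l A) =
      ((l.map Prod.swap).map fun p =>
        divMat r (Matrix.single p.1 p.2 1 : Gl n) (offDiagPart A p)).prod := by
  rw [fProd, map_list_prod, List.map_map, List.map_map]
  refine congrArg _ (List.map_congr_left fun p hp => ?_)
  have h := ((hl.2 p).1 hp).ne'
  rw [Function.comp_apply, Function.comp_apply, f, matRep_divPow h, offDiagPart_apply,
    Prod.fst_swap, Prod.snd_swap, if_neg h]

/-- As `f_{ij} = e_{ji}`, the swapped list runs over the pairs below the diagonal. -/
theorem nodup_and_mem_of_isOrdering {lf le : List (Fin n × Fin n)} (hlf : IsOrdering lf)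
    (hle : IsOrdering le) : (lf.map Prod.swap ++ le).Nodup ∧
      ∀ p : Fin n × Fin n, p ∈ lf.map Prod.swap ++ le ↔ p.1 ≠ p.2 := by
  have hswap : ∀ p : Fin n × Fin n, p ∈ lf.map Prod.swap ↔ p.2 < p.1 := by
    intro p
    rw [show p.2 < p.1 ↔ p.swap ∈ lf from (hlf.2 p.swap).symm, List.mem_map]
    exact ⟨by rintro ⟨q, hq, rfl⟩; rwa [Prod.swap_swap], fun h => ⟨_, h, p.swap_swap⟩⟩
  refine ⟨List.Nodup.append (hlf.1.map Prod.swap_injective) hle.1 fun p hp hp' => ?_, fun p => ?_⟩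
  · exact lt_asymm ((hswap p).1 hp) ((hle.2 p).1 hp')
  · rw [List.mem_append, hswap, hle.2, or_comm, lt_or_lt_iff_ne]

end Basis

end IntegralSchur

end

open IntegralSchur in
theorem mainTheorem3 (n r : ℕ) (lam mu : Fin n → ℕ)
    (hlam : lam ∈ Comps n r) (hmu : mu ∈ Comps n r)
    (lf le : List (Fin n × Fin n)) (hlf : IsOrdering lf) (hle : IsOrdering le) :
    (∃ b : Module.Basis (Theta lam mu) ℤ (SZweight n r lam mu),
      ∀ A : Theta lam mu, (b A : Module.End ℚ (TensorSpace n r)) =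
        idem lam * dRho n r (fProd lf A * eProd le A) * idem mu) ∧
    (∃ b : Module.Basis (Theta lam mu) ℤ (SZweight n r lam mu),
      ∀ A : Theta lam mu, (b A : Module.End ℚ (TensorSpace n r)) =
        idem lam * dRho n r (eProd le A * fProd lf A) * idem mu) := by
  obtain ⟨hnd, hmem⟩ := nodup_and_mem_of_isOrdering hlf hle
  constructor
  · refine exists_basis_of_matRep_eq lam mu hlam hnd hmem (fun A => fProd lf A * eProd le A)
      fun A => ?_
    rw [map_mul, matRep_fProd hlf, matRep_eProd hle, List.map_append, List.prod_append]
  · refine exists_basis_of_matRep_eq lam mu hlam (List.perm_append_comm.nodup hnd)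
      (fun p => List.perm_append_comm.mem_iff.trans (hmem p)) (fun A => eProd le A * fProd lf A)
      fun A => ?_
    rw [map_mul, matRep_fProd hlf, matRep_eProd hle, List.map_append, List.prod_append]
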